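/- Let $\mathbf k$ be a field of characteristic zero and let $A=(a_1,\dots,a_n)=(a_{ij})$ be an integer $d\times n$ matrix of rank $d$ whose columns $a_j$ all lie on one hyperplane of $\mathbf Q^d$ not passing through the origin. Let $\mathbf NA$ and $\mathbf ZA$ be the semigroup and the group generated by the columns. Let $D=\mathbf k\langle x_1,\dots,x_n,\partial_1,\dots,\partial_n\rangle$ be the Weyl algebra, $I_A=\langle \partial^u-\partial^v : u,v\in\mathbf N^n,\ Au=Av\rangle\subset\mathbf k[\partial]$ the toric ideal, and put $s_i=\sum_j a_{ij}x_j\partial_j$ for $i=1,\dots,d$. For $\beta\in\mathbf k^d$ let $H_A(\beta)$ be the left ideal of $D$ generated by $I_A$ and $s_1-\beta_1,\dots,s_d-\beta_d$, and let $M_A(\beta)=D/H_A(\beta)$. Let $\tilde S=\{P\in D : I_AP\subset DI_A\}$, let $S=\tilde S/(\tilde S\cap DI_A)$ be the symmetry algebra, and for $\chi\in\mathbf ZA$ let $S_\chi=\{P\in S : [s_i,P]=\chi_iP \text{ for } i=1,\dots,d\}$. The homomorphism from the polynomial ring $\mathbf k[s]=\mathbf k[s_1,\dots,s_d]$ to $D$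 that sends $s_i$ to $\sum_j a_{ij}x_j\partial_j$ has image in $\tilde S$; it is used to view polynomials in $s$ as elements of $D$ and of $S$. For $\chi\in\mathbf ZA$ put $$M_\chi=\langle \partial^u : u\in\mathbf N^n,\ Au\in\chi+\mathbf NA\rangle\subset\mathbf k[\partial],\qquad I_\chi=I_A+M_\chi,\qquad B_\chi=\mathbf k[s]\cap DI_\chi,$$ $$B_{-\chi,\chi}=\langle\, p_\chi(s+\chi)\,p_{-\chi}(s) : p_\chi\in B_\chi,\ p_{-\chi}\in B_{-\chi}\,\rangle\subset\mathbf k[s],$$ and let $V(B_{-\chi,\chi})\subset\mathbf k^d$ be its zero set. Say that $E\in S_\chi$ corresponds to $b\in B_\chi$ if $b\,\partial^{v}=E\,\partial^{u}$ in $S$ for all $u,v\in\mathbf N^n$ with $\chi=Au-Av$. **Theorem.** Let $\chi\in\mathbf ZA$ and $\beta\in\mathbf k^d$ with $\beta\notin V(B_{-\chi,\chi})$. Then the $D$-modules $M_A(\beta)$ and $M_A(\beta+\chi)$ are isomorphic. More precisely, there are $p_\chi\in B_\chi$ and $p_{-\chi}\in B_{-\chi}$ with $c:=p_\chi(\beta+\chi)\,p_{-\chi}(\beta)\neq0$;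 and for every such pair there are operators $P_\chi\in S_\chi$ and $P_{-\chi}\in S_{-\chi}$ corresponding to $p_\chi$ and $p_{-\chi}$ respectively, and any such operators satisfy $$P_{-\chi}P_\chi=p_\chi(s+\chi)\,p_{-\chi}(s),\qquad P_\chi P_{-\chi}=p_{-\chi}(s-\chi)\,p_\chi(s)$$ in $S$; right multiplication by $P_{-\chi}$ and by $P_\chi$ induces isomorphisms of $D$-modules $f\colon M_A(\beta)\to M_A(\beta+\chi)$ and $g\colon M_A(\beta+\chi)\to M_A(\beta)$ respectively, and $g\circ f=c\cdot\mathrm{id}$, $f\circ g=c\cdot\mathrm{id}$. -/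

import Mathlib

namespace GKZ

noncomputable section

open MvPolynomial

/-- Generators of the Weyl algebra in `n` variables. -/
inductive WeylGen (n : ℕ) : Type
  | x (i : Fin n) : WeylGen n
  | d (i : Fin n) : WeylGen n

/-- Defining relations of the Weyl algebra: the `x i` commute, the `∂ i` commute and
`∂ i * x j = x j * ∂ i + δ_{ij}`. -/
inductive WeylRel (k : Type*) [Field k] (n : ℕ) :
    FreeAlgebra k (WeylGen n) → FreeAlgebra k (WeylGen n) → Prop
  | xx (i j : Fin n) : WeylRel k n
      (FreeAlgebra.ι k (WeylGen.x i) * FreeAlgebra.ι k (WeylGen.x j))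
      (FreeAlgebra.ι k (WeylGen.x j) * FreeAlgebra.ι k (WeylGen.x i))
  | dd (i j : Fin n) : WeylRel k n
      (FreeAlgebra.ι k (WeylGen.d i) * FreeAlgebra.ι k (WeylGen.d j))
      (FreeAlgebra.ι k (WeylGen.d j) * FreeAlgebra.ι k (WeylGen.d i))
  | dx (i j : Fin n) : WeylRel k n
      (FreeAlgebra.ι k (WeylGen.d i) * FreeAlgebra.ι k (WeylGen.x j))
      (FreeAlgebra.ι k (WeylGen.x j) * FreeAlgebra.ι k (WeylGen.d i) + if i = j then 1 else 0)

/-- The Weyl algebra `D = k⟨x_1, …, x_n, ∂_1, …, ∂_n⟩`. -/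
def Weyl (k : Type*) [Field k] (n : ℕ) : Type _ := RingQuot (WeylRel k n)

instance (k : Type*) [Field k] (n : ℕ) : Ring (Weyl k n) :=
  inferInstanceAs (Ring (RingQuot (WeylRel k n)))

instance (k : Type*) [Field k] (n : ℕ) : Algebra k (Weyl k n) :=
  inferInstanceAs (Algebra k (RingQuot (WeylRel k n)))

/-- The projection from the free algebra to the Weyl algebra. -/
def weylMk (k : Type*) [Field k] (n : ℕ) : FreeAlgebra k (WeylGen n) →ₐ[k] Weyl k n :=
  RingQuot.mkAlgHom k (WeylRel k n)

theorem weylMk_rel {k : Type*} [Field k] {n : ℕ} {a b : FreeAlgebra k (WeylGen n)}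
    (h : WeylRel k n a b) : weylMk k n a = weylMk k n b :=
  RingQuot.mkAlgHom_rel k h

/-- Evaluation of a polynomial at a family of pairwise commuting elements of a (possibly
noncommutative) algebra. -/
def commAeval {k σ R : Type*} [Field k] [Ring R] [Algebra k R] (f : σ → R)
    (hf : ∀ i j, f i * f j = f j * f i) : MvPolynomial σ k →ₐ[k] R :=
  letI : CommRing (Algebra.adjoin k (Set.range f)) :=
    { (inferInstance : Ring (Algebra.adjoin k (Set.range f))) with
      mul_comm := (Algebra.isMulCommutative_adjoin k (by
        rintro _ ⟨i, rfl⟩ _ ⟨j, rfl⟩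
        exact hf i j)).is_comm.comm }
  (Algebra.adjoin k (Set.range f)).val.comp
    (aeval (fun i => ⟨f i, Algebra.subset_adjoin ⟨i, rfl⟩⟩))

theorem commAeval_X {k σ R : Type*} [Field k] [Ring R] [Algebra k R] (f : σ → R)
    (hf : ∀ i j, f i * f j = f j * f i) (i : σ) : commAeval (k := k) f hf (X i) = f i := by
  simp [commAeval]

section

variable (k : Type*) [Field k] {d n : ℕ}

/-- The element `x_i` of the Weyl algebra. -/
def xx (i : Fin n) : Weyl k n :=
  weylMk k n (FreeAlgebra.ι k (WeylGen.x i))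

/-- The element `∂_i` of the Weyl algebra. -/
def dd (i : Fin n) : Weyl k n :=
  weylMk k n (FreeAlgebra.ι k (WeylGen.d i))

theorem xx_mul_xx (i j : Fin n) : xx k i * xx k j = xx k j * xx k i := by
  simpa [xx] using weylMk_rel (WeylRel.xx (k := k) i j)

theorem dd_mul_dd (i j : Fin n) : dd k i * dd k j = dd k j * dd k i := by
  simpa [dd] using weylMk_rel (WeylRel.dd (k := k) i j)

theorem dd_mul_xx (i j : Fin n) :
    dd k i * xx k j = xx k j * dd k i + if i = j then 1 else 0 := by
  have h := weylMk_rel (WeylRel.dx (k := k) i j)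
  split_ifs at h ⊢ <;> simpa [xx, dd] using h

/-- The Euler operator `θ_j = x_j ∂_j`. -/
def theta (j : Fin n) : Weyl k n := xx k j * dd k j

theorem dd_mul_theta (i j : Fin n) :
    dd k i * theta k j = theta k j * dd k i + if i = j then dd k i else 0 := by
  rw [theta, ← mul_assoc, dd_mul_xx, add_mul, mul_assoc, dd_mul_dd k i j, ← mul_assoc]
  split_ifs with h
  · subst h; simp
  · simp

theorem theta_mul_theta (i j : Fin n) : theta k i * theta k j = theta k j * theta k i := by
  by_cases h : i = j
  · rw [h]
  · have h1 : dd k i * theta k j = theta k j * dd k i := by simp [dd_mul_theta, h]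
    have h2 : xx k i * theta k j = theta k j * xx k i := by
      have h3 : xx k i * dd k j = dd k j * xx k i := by
        simp [dd_mul_xx, Ne.symm h]
      rw [theta, ← mul_assoc, xx_mul_xx, mul_assoc, h3, mul_assoc]
    conv_lhs => rw [theta, mul_assoc, h1, ← mul_assoc, h2, mul_assoc, ← theta]

variable (A : Matrix (Fin d) (Fin n) ℤ)

/-- The vector `A u ∈ ℤ^d` for `u ∈ ℕ^n`. -/
def deg (u : Fin n →₀ ℕ) : Fin d → ℤ := A.mulVec (fun j => (u j : ℤ))

/-- The semigroup `ℕA` generated by the columns of `A`. -/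
def semigroupNA : AddSubmonoid (Fin d → ℤ) :=
  AddSubmonoid.closure (Set.range fun j : Fin n => fun i => A i j)

/-- The lattice `ℤA` generated by the columns of `A`. -/
def latticeZA : AddSubgroup (Fin d → ℤ) :=
  AddSubgroup.closure (Set.range fun j : Fin n => fun i => A i j)

/-- A vector of `ℤ^d` viewed in `k^d`. -/
def castVec (χ : Fin d → ℤ) : Fin d → k := fun i => (χ i : k)

/-- The inclusion `k[∂] → D`. -/
def diffHom : MvPolynomial (Fin n) k →ₐ[k] Weyl k n := commAeval (dd k) (dd_mul_dd k)

/-- The toric ideal `I_A` of `k[∂]`. -/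
def toricIdeal : Ideal (MvPolynomial (Fin n) k) :=
  Ideal.span {f | ∃ u v : Fin n →₀ ℕ, deg A u = deg A v ∧ f = monomial u 1 - monomial v 1}

/-- The left ideal `D I` of the Weyl algebra generated by an ideal `I` of `k[∂]`. -/
def leftIdeal (I : Ideal (MvPolynomial (Fin n) k)) : Ideal (Weyl k n) := Ideal.map (diffHom k) I

/-- The operator `s_i = ∑_j a_{ij} θ_j`. -/
def euler (i : Fin d) : Weyl k n := ∑ j, (A i j : k) • theta k j

theorem euler_mul_euler (i j : Fin d) : euler k A i * euler k A j = euler k A j * euler k A i := by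
  have h : ∀ i j : Fin d, Commute (euler k A i) (euler k A j) := fun i j =>
    Commute.sum_left _ _ _ fun a _ => Commute.sum_right _ _ _ fun b _ =>
      ((show Commute _ _ from theta_mul_theta k a b).smul_left _).smul_right _
  exact h i j

/-- The homomorphism `k[s] = k[s_1, …, s_d] → D` with `s_i ↦ ∑_j a_{ij} θ_j`. -/
def eulerHom : MvPolynomial (Fin d) k →ₐ[k] Weyl k n :=
  commAeval (euler k A) (euler_mul_euler k A)

/-- The left ideal `H_A(β)`, generated by `I_A` and the operators `∑_j a_{ij} θ_j - β_i`. -/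
def hypergeomIdeal (β : Fin d → k) : Ideal (Weyl k n) :=
  leftIdeal k (toricIdeal k A) ⊔
    Ideal.span (Set.range fun i => euler k A i - algebraMap k (Weyl k n) (β i))

/-- The `A`-hypergeometric system `M_A(β) = D / H_A(β)`, a left `D`-module. -/
abbrev HypergeomSystem (β : Fin d → k) : Type _ := Weyl k n ⧸ hypergeomIdeal k A β

/-- The algebra `S̃ = {P ∈ D | I_A P ⊆ D I_A}`. -/
def preSymmetry : Subalgebra k (Weyl k n) where
  carrier := {P | ∀ f ∈ toricIdeal k A, diffHom k f * P ∈ leftIdeal k (toricIdeal k A)}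
  add_mem' hP hQ f hf := by rw [mul_add]; exact add_mem (hP f hf) (hQ f hf)
  algebraMap_mem' c f hf := by
    rw [← Algebra.commutes]
    exact Ideal.mul_mem_left _ _ (Ideal.mem_map_of_mem _ hf)
  mul_mem' {P Q} hP hQ f hf := by
    rw [← mul_assoc]
    refine Submodule.span_induction (p := fun R _ => R * Q ∈ leftIdeal k (toricIdeal k A))
      ?_ ?_ ?_ ?_ (hP f hf)
    · rintro _ ⟨g, hg, rfl⟩
      exact hQ g hg
    · simp
    · intro R R' _ _ h h'
      rw [add_mul]; exact add_mem h h'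
    · intro c R _ h
      rw [smul_eq_mul, mul_assoc]; exact Ideal.mul_mem_left _ _ h

/-- The ideal `S̃ ∩ D I_A` of `S̃`. -/
def symmetryIdeal : Ideal (preSymmetry k A) :=
  Ideal.comap (preSymmetry k A).val (leftIdeal k (toricIdeal k A))

instance : (symmetryIdeal k A).IsTwoSided where
  mul_mem_of_left {R} Q hR := by
    change (R : Weyl k n) * (Q : Weyl k n) ∈ leftIdeal k (toricIdeal k A)
    refine Submodule.span_induction
      (p := fun R _ => R * (Q : Weyl k n) ∈ leftIdeal k (toricIdeal k A)) ?_ ?_ ?_ ?_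
      (show (R : Weyl k n) ∈ Submodule.span _ _ from hR)
    · rintro _ ⟨g, hg, rfl⟩
      exact Q.2 g hg
    · simp
    · intro R R' _ _ h h'
      rw [add_mul]; exact add_mem h h'
    · intro c R _ h
      rw [smul_eq_mul, mul_assoc]; exact Ideal.mul_mem_left _ _ h

/-- The symmetry algebra `S = S̃ / (S̃ ∩ D I_A)`. -/
abbrev Symmetry : Type _ := preSymmetry k A ⧸ symmetryIdeal k A

/-- The class in `S` of an operator of `S̃`. -/
def toSymmetry : preSymmetry k A →ₐ[k] Symmetry k A := Ideal.Quotient.mkₐ k (symmetryIdeal k A)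

theorem diffHom_mem (g : MvPolynomial (Fin n) k) : diffHom k g ∈ preSymmetry k A := by
  intro f hf
  rw [← map_mul, mul_comm, map_mul]
  exact Ideal.mul_mem_left _ _ (Ideal.mem_map_of_mem _ hf)

/-- The homomorphism `k[∂] → S`. -/
def diffSymm : MvPolynomial (Fin n) k →ₐ[k] Symmetry k A :=
  (toSymmetry k A).comp ((diffHom k).codRestrict (preSymmetry k A) (diffHom_mem k A))

theorem dd_mul_euler (l : Fin n) (i : Fin d) :
    dd k l * euler k A i = euler k A i * dd k l + (A i l : k) • dd k l := by
  simp only [euler, Finset.mul_sum, Finset.sum_mul, mul_smul_comm, smul_mul_assoc, dd_mul_theta,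
    smul_add, Finset.sum_add_distrib]
  simp

theorem deg_zero (i : Fin d) : deg A 0 i = 0 := by
  simp [deg, Matrix.mulVec, dotProduct]

theorem diffHom_monomial_mul_euler (u : Fin n →₀ ℕ) (i : Fin d) :
    diffHom k (monomial u 1) * euler k A i =
      euler k A i * diffHom k (monomial u 1) + (deg A u i : k) • diffHom k (monomial u 1) := by
  induction u using Finsupp.induction_linear with
  | zero => simp [deg_zero]
  | add u v hu hv =>
    have e : (monomial (u + v) (1 : k)) = monomial u 1 * monomial v 1 := by simp
    have e' : deg A (u + v) i = deg A u i + deg A v i := by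
      simp [deg, Matrix.mulVec, dotProduct, mul_add, Finset.sum_add_distrib]
    rw [e, map_mul, mul_assoc, hv, mul_add, ← mul_assoc, hu, e']
    push_cast
    simp only [add_mul, mul_smul_comm, smul_mul_assoc, add_smul, mul_assoc]
    abel
  | single l m =>
    induction m with
    | zero => simp [deg_zero]
    | succ m ih =>
      have e : (monomial (Finsupp.single l (m + 1)) (1 : k)) =
          monomial (Finsupp.single l m) 1 * X l := by
        rw [X, monomial_mul, ← Finsupp.single_add, one_mul]
      have e' : deg A (Finsupp.single l (m + 1)) i = deg A (Finsupp.single l m) i + A i l := by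
        rw [Finsupp.single_add]
        simp only [deg, Matrix.mulVec, dotProduct, Finsupp.add_apply]
        push_cast
        simp only [mul_add, Finset.sum_add_distrib]
        simp [Finsupp.single_apply]
      have eX : diffHom k (X l) = dd k l := commAeval_X _ _ _
      rw [e, map_mul, eX, mul_assoc, dd_mul_euler, mul_add, ← mul_assoc, ih, e']
      push_cast
      simp only [add_mul, mul_smul_comm, smul_mul_assoc, add_smul, mul_assoc]
      abel

theorem euler_mem (i : Fin d) : euler k A i ∈ preSymmetry k A := by
  intro f hf
  refine Submodule.span_induction
    (p := fun f _ => diffHom k f * euler k A i ∈ leftIdeal k (toricIdeal k A)) ?_ ?_ ?_ ?_ hf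
  · rintro _ ⟨u, v, huv, rfl⟩
    have hm : diffHom k (monomial u 1 - monomial v 1) ∈ leftIdeal k (toricIdeal k A) :=
      Ideal.mem_map_of_mem _ (Ideal.subset_span ⟨u, v, huv, rfl⟩)
    have e : diffHom k (monomial u 1 - monomial v 1) * euler k A i =
        (euler k A i + algebraMap k _ (deg A u i : k)) *
          diffHom k (monomial u 1 - monomial v 1) := by
      rw [map_sub, sub_mul, diffHom_monomial_mul_euler, diffHom_monomial_mul_euler, huv,
        add_mul, mul_sub, ← Algebra.smul_def, smul_sub]
      abel
    rw [e]
    exact Ideal.mul_mem_left _ _ hm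
  · simp
  · intro f g _ _ h h'
    rw [map_add, add_mul]; exact add_mem h h'
  · intro c f _ h
    rw [smul_eq_mul, map_mul, mul_assoc]; exact Ideal.mul_mem_left _ _ h

theorem eulerHom_mem (p : MvPolynomial (Fin d) k) : eulerHom k A p ∈ preSymmetry k A := by
  induction p using MvPolynomial.induction_on with
  | C c =>
    rw [← algebraMap_eq, AlgHom.commutes]
    exact Subalgebra.algebraMap_mem _ _
  | add p q hp hq => rw [map_add]; exact add_mem hp hq
  | mul_X p i hp =>
    rw [map_mul]
    refine mul_mem hp ?_
    rw [eulerHom, commAeval_X]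
    exact euler_mem k A i

/-- The homomorphism `k[s] → S` with `s_i ↦ ∑_j a_{ij} θ_j`. -/
def eulerSymm : MvPolynomial (Fin d) k →ₐ[k] Symmetry k A :=
  (toSymmetry k A).comp ((eulerHom k A).codRestrict (preSymmetry k A) (eulerHom_mem k A))

/-- The weight space `S_χ = {P ∈ S | [s_i, P] = χ_i P for all i}`. -/
def weightSpace (χ : Fin d → ℤ) : Submodule k (Symmetry k A) where
  carrier := {P | ∀ i, eulerSymm k A (X i) * P - P * eulerSymm k A (X i) = (χ i : k) • P}
  add_mem' hP hQ i := by rw [mul_add, add_mul, smul_add, ← hP i, ← hQ i]; abel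
  zero_mem' i := by simp
  smul_mem' c P hP i := by
    rw [mul_smul_comm, smul_mul_assoc, ← smul_sub, hP i, smul_comm]

/-- The monomial ideal `M_χ` of `k[∂]` generated by the `∂^u` with `Au ∈ χ + ℕA`. -/
def monomialIdeal (χ : Fin d → ℤ) : Ideal (MvPolynomial (Fin n) k) :=
  Ideal.span {f | ∃ u : Fin n →₀ ℕ, (∃ γ ∈ semigroupNA A, deg A u = χ + γ) ∧ f = monomial u 1}

/-- The ideal of `b`-polynomials `B_χ = k[s] ∩ D I_χ`, where `I_χ = I_A + M_χ`. -/
def bIdeal (χ : Fin d → ℤ) : Ideal (MvPolynomial (Fin d) k) :=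
  Ideal.comap (eulerHom k A) (leftIdeal k (toricIdeal k A ⊔ monomialIdeal k A χ))

/-- The translate `p(s + χ)` of a polynomial `p(s)`. -/
def shift (χ : Fin d → ℤ) : MvPolynomial (Fin d) k →ₐ[k] MvPolynomial (Fin d) k :=
  aeval fun i => X i + C (χ i : k)

/-- The ideal `B_{-χ,χ}` generated by the products `p_χ(s + χ) p_{-χ}(s)` with `p_χ ∈ B_χ` and
`p_{-χ} ∈ B_{-χ}`. -/
def bbIdeal (χ : Fin d → ℤ) : Ideal (MvPolynomial (Fin d) k) :=
  Ideal.span {f | ∃ p ∈ bIdeal k A χ, ∃ q ∈ bIdeal k A (-χ), f = shift k χ p * q}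

/-- `E ∈ S_χ` is the contiguity operator attached to `b`: one has `b ∂^v = E ∂^u` in the symmetry
algebra for every expression `χ = Au - Av` with `u, v ∈ ℕ^n`. -/
def IsContiguity (χ : Fin d → ℤ) (b : MvPolynomial (Fin d) k) (E : Symmetry k A) : Prop :=
  E ∈ weightSpace k A χ ∧ ∀ u v : Fin n →₀ ℕ, deg A u - deg A v = χ →
    eulerSymm k A b * diffSymm k A (monomial v 1) = E * diffSymm k A (monomial u 1)

/-- The map `φ : M_A(β) → M_A(β')` is right multiplication by `P ∈ S`: the class of `Q` is sent to
the class of `Q R`, for every `Q ∈ D` and every representative `R ∈ S̃` of `P`. -/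
def IsRightMul {β β' : Fin d → k} (φ : HypergeomSystem k A β → HypergeomSystem k A β')
    (P : Symmetry k A) : Prop :=
  ∀ R : preSymmetry k A, toSymmetry k A R = P → ∀ Q : Weyl k n,
    φ (Submodule.Quotient.mk Q) = Submodule.Quotient.mk (Q * (R : Weyl k n))

end

end

end GKZ

/-! Everything rests on one cancellation principle: if `P ∂^u` lies in `D I_A`, so does `P`. Writing
operators with the `x` to the left of the `∂` turns right multiplication by `f ∈ k[∂]` into
multiplication of the coefficients by `f`, so membership in `D I` is tested coefficientwise
(`mem_leftIdeal_iff`). It remains to cancel `∂^u` modulo `I_A`, and this works because `I_A` is the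
kernel of `∂^u ↦ t^{Au}` and each `t^{Au}` is a unit of the group algebra.

A `b`-polynomial `b ∈ D I_χ` satisfies `b ∂^v ≡ E ∂^u` modulo `D I_A` for some `E`. Cancelling `∂^u`
shows that `E` is a symmetry of weight `χ` (`exists_isContiguity`), and also identifies the product
of two opposite contiguity operators with a polynomial in `s` (`IsContiguity.mul_eq`).

Right multiplication by a symmetry of weight `χ` lowers the parameter by `χ`, while a polynomial
`r(s)` acts on `M_A(β)` from the right as the scalar `r(β)`. Both composites are therefore the
constant `c`, and `c ≠ 0` makes the two maps inverse up to scaling. -/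

namespace GKZ

noncomputable section

open MvPolynomial

/-! ### Normal forms in the Weyl algebra and left ideals generated from `k[∂]`. -/

section NormalForm

variable (k : Type*) [Field k] {n : ℕ}

/-- The action of the Weyl algebra on `k[∂][x]` in which `x_i` acts by multiplication and `∂_i`
acts as `∂/∂x_i` plus multiplication by the coefficient `∂_i`. It is linear over `k[∂]`. -/
def weylAction : Weyl k n →ₐ[k] Module.End (MvPolynomial (Fin n) k)
    (MvPolynomial (Fin n) (MvPolynomial (Fin n) k)) :=
  RingQuot.liftAlgHom k ⟨FreeAlgebra.lift k fun
    | WeylGen.x i => LinearMap.mulLeft _ (X i)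
    | WeylGen.d i => (pderiv i : Derivation _ _ _).toLinearMap + LinearMap.mulLeft _ (C (X i)), by
    intro a b h
    cases h with
    | xx i j =>
      ext1 F
      simp only [map_mul, FreeAlgebra.lift_ι_apply]
      refine LinearMap.ext fun G => ?_
      simp [mul_left_comm]
    | dd i j =>
      simp only [map_mul, FreeAlgebra.lift_ι_apply]
      refine LinearMap.ext fun G => ?_
      -- The commutator of two derivations is a derivation, and this one kills every variable.
      have h : pderiv i (pderiv j G) = pderiv j (pderiv i G) := by
        have h1 := congrArg (fun D => D G)
          (show ⁅pderiv i, pderiv j⁆ =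
            (0 : Derivation (MvPolynomial (Fin n) k) (MvPolynomial (Fin n) _) _) from by
              refine derivation_ext fun l => ?_
              rw [Derivation.commutator_apply]
              simp [pderiv_X, Pi.single_apply, apply_ite])
        simpa [Derivation.commutator_apply, sub_eq_zero] using h1
      simp [h]
      ring
    | dx i j =>
      simp only [map_mul, map_add, FreeAlgebra.lift_ι_apply]
      refine LinearMap.ext fun G => ?_
      split_ifs with h
      · subst h
        simp
        ring
      · simp [pderiv_X_of_ne (Ne.symm h)]
        ring⟩

theorem weylAction_xx (i : Fin n) (F : MvPolynomial (Fin n) (MvPolynomial (Fin n) k)) :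
    weylAction k (xx k i) F = X i * F := by
  simp only [weylAction, xx, weylMk]
  erw [RingQuot.liftAlgHom_mkAlgHom_apply]
  simp

theorem weylAction_dd (i : Fin n) (F : MvPolynomial (Fin n) (MvPolynomial (Fin n) k)) :
    weylAction k (dd k i) F = pderiv i F + C (X i) * F := by
  simp only [weylAction, dd, weylMk]
  erw [RingQuot.liftAlgHom_mkAlgHom_apply]
  simp

/-- The inclusion `k[x] → D`. -/
def coordHom : MvPolynomial (Fin n) k →ₐ[k] Weyl k n := commAeval (xx k) (xx_mul_xx k)

theorem coordHom_X (i : Fin n) : coordHom k (X i) = xx k i := commAeval_X _ _ _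

theorem diffHom_X (i : Fin n) : diffHom k (X i) = dd k i := commAeval_X _ _ _

theorem dd_mul_coordHom (i : Fin n) (g : MvPolynomial (Fin n) k) :
    dd k i * coordHom k g = coordHom k g * dd k i + coordHom k (pderiv i g) := by
  induction g using MvPolynomial.induction_on with
  | C c =>
    rw [pderiv_C, map_zero, add_zero, ← algebraMap_eq, AlgHom.commutes, Algebra.commutes]
  | add p q hp hq => simp only [map_add, mul_add, add_mul, hp, hq]; abel
  | mul_X p j hp =>
    rw [map_mul, ← mul_assoc, hp, add_mul, mul_assoc, coordHom_X, dd_mul_xx, Derivation.leibniz,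
      mul_add, map_add, smul_eq_mul, smul_eq_mul, mul_comm (X j), map_mul, map_mul, coordHom_X,
      mul_assoc, add_assoc]
    by_cases h : i = j
    · subst h; simp
    · simp [h, pderiv_X_of_ne (Ne.symm h)]

/-- The map `k[∂][x] → D` that writes the variables `x` to the left of the `∂`. -/
def normalOrder : MvPolynomial (Fin n) (MvPolynomial (Fin n) k) →ₗ[k] Weyl k n :=
  (Finsupp.lsum k fun α => (LinearMap.mulLeft k (coordHom k (monomial α 1))).comp
    (diffHom k).toLinearMap).comp
    ((basisMonomials (Fin n) (MvPolynomial (Fin n) k)).repr.restrictScalars k).toLinearMap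

theorem normalOrder_monomial (α : Fin n →₀ ℕ) (f : MvPolynomial (Fin n) k) :
    normalOrder k (monomial α f) = coordHom k (monomial α 1) * diffHom k f := by
  have h : monomial α f = f • basisMonomials (Fin n) (MvPolynomial (Fin n) k) α := by
    simp [smul_monomial]
  simp only [normalOrder, LinearMap.comp_apply, h]
  simp [-coe_basisMonomials, -map_smul]

theorem normalOrder_map_mul_C (g f : MvPolynomial (Fin n) k) :
    normalOrder k (map C g * C f) = coordHom k g * diffHom k f := by
  induction g using MvPolynomial.induction_on' with
  | monomial α c =>
    rw [map_monomial, mul_comm, C_mul_monomial, normalOrder_monomial, map_mul,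
      ← algebraMap_eq, AlgHom.commutes, ← Algebra.commutes, ← mul_assoc, ← Algebra.commutes,
      ← Algebra.smul_def, ← map_smul, smul_monomial, smul_eq_mul, mul_one]
  | add p q hp hq => rw [map_add, add_mul, map_add, hp, hq, map_add, add_mul]

/-- `normalOrder` is only `k`-linear and not multiplicative, but products `g(x) f(∂)` span
additively and its value on them is explicit. -/
theorem normalOrder_induction {motive : MvPolynomial (Fin n) (MvPolynomial (Fin n) k) → Prop}
    (map_mul_C : ∀ g f, motive (map C g * C f))
    (add : ∀ F G, motive F → motive G → motive (F + G)) (F) : motive F := by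
  induction F using MvPolynomial.induction_on' with
  | monomial α f =>
    have h : monomial α f = map C (monomial α (1 : k)) * C f := by
      rw [map_monomial, mul_comm, C_mul_monomial, map_one, mul_one]
    rw [h]; exact map_mul_C _ _
  | add p q hp hq => exact add _ _ hp hq

theorem normalOrder_X_mul (i : Fin n) (F : MvPolynomial (Fin n) (MvPolynomial (Fin n) k)) :
    normalOrder k (X i * F) = xx k i * normalOrder k F := by
  induction F using normalOrder_induction with
  | map_mul_C g f =>
    rw [← mul_assoc, ← map_X (C : k →+* _) i, ← map_mul, normalOrder_map_mul_C,
      normalOrder_map_mul_C, map_mul, coordHom_X, mul_assoc]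
  | add F G hF hG => rw [mul_add, map_add, hF, hG, map_add, mul_add]

/-- This is the commutation rule `∂_i g(x) = g(x) ∂_i + ∂g/∂x_i`, applied with `f(∂)` on the right.
-/
theorem normalOrder_dd (i : Fin n) (F : MvPolynomial (Fin n) (MvPolynomial (Fin n) k)) :
    normalOrder k (pderiv i F + C (X i) * F) = dd k i * normalOrder k F := by
  induction F using normalOrder_induction with
  | map_mul_C g f =>
    have h : pderiv i (map C g * C f) + C (X i) * (map C g * C f) =
        map C (pderiv i g) * C f + map C g * C (X i * f) := by
      rw [Derivation.leibniz, pderiv_C, pderiv_map, smul_eq_mul, smul_eq_mul, C_mul]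
      ring
    rw [h, map_add, normalOrder_map_mul_C, normalOrder_map_mul_C, normalOrder_map_mul_C,
      ← mul_assoc, dd_mul_coordHom, map_mul, diffHom_X, add_mul, mul_assoc, add_comm]
  | add F G hF hG =>
    rw [map_add (pderiv i), mul_add, add_add_add_comm, map_add, hF, hG, map_add, mul_add]

theorem weyl_induction {motive : Weyl k n → Prop}
    (algebraMap : ∀ c : k, motive (algebraMap k _ c))
    (xx : ∀ i, motive (xx k i)) (dd : ∀ i, motive (dd k i))
    (mul : ∀ P Q, motive P → motive Q → motive (P * Q))
    (add : ∀ P Q, motive P → motive Q → motive (P + Q)) (P) : motive P := by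
  obtain ⟨a, rfl⟩ : ∃ a, weylMk k n a = P := RingQuot.mkAlgHom_surjective k _ P
  induction a using FreeAlgebra.induction with
  | grade0 c => rw [AlgHom.commutes]; exact algebraMap c
  | grade1 g => cases g with
    | x i => exact xx i
    | d i => exact dd i
  | mul a b ha hb => rw [map_mul]; exact mul _ _ ha hb
  | add a b ha hb => rw [map_add]; exact add _ _ ha hb

/-- Applied to `F = 1`, this makes `normalOrder` recover `P` from its symbol. -/
theorem normalOrder_weylAction (P : Weyl k n) :
    ∀ F, normalOrder k (weylAction k P F) = P * normalOrder k F := by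
  induction P using weyl_induction with
  | algebraMap c =>
    intro F
    rw [AlgHom.commutes, Module.algebraMap_end_apply, map_smul, Algebra.smul_def]
  | xx i => intro F; rw [weylAction_xx, normalOrder_X_mul]
  | dd i => intro F; rw [weylAction_dd, normalOrder_dd]
  | mul P Q hP hQ => intro F; rw [map_mul, Module.End.mul_apply, hP, hQ, mul_assoc]
  | add P Q hP hQ => intro F; rw [map_add, LinearMap.add_apply, map_add, hP, hQ, add_mul]

/-- The normally ordered symbol of an operator, as a polynomial in `x` over `k[∂]`. -/
def symbol (P : Weyl k n) : MvPolynomial (Fin n) (MvPolynomial (Fin n) k) := weylAction k P 1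

theorem normalOrder_symbol (P : Weyl k n) : normalOrder k (symbol k P) = P := by
  have h := normalOrder_map_mul_C k (n := n) 1 1
  simp only [map_one, mul_one] at h
  rw [symbol, normalOrder_weylAction, h, mul_one]

theorem weylAction_diffHom_C (f g : MvPolynomial (Fin n) k) :
    weylAction k (diffHom k f) (C g) = C (f * g) := by
  induction f using MvPolynomial.induction_on generalizing g with
  | C c =>
    rw [← algebraMap_eq, AlgHom.commutes, AlgHom.commutes, Module.algebraMap_end_apply,
      algebraMap_eq, C_mul', C_eq_smul_one, C_eq_smul_one, smul_assoc]
  | add p q hp hq => rw [map_add, map_add, LinearMap.add_apply, hp, hq, add_mul, map_add]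
  | mul_X p i hp =>
    rw [map_mul, map_mul, Module.End.mul_apply, diffHom_X, weylAction_dd, pderiv_C, zero_add,
      ← C_mul, hp, mul_assoc]

/-- `f(∂)` sends the vector `1` to the scalar multiple `f • 1`, and the action of `P` is linear over
`k[∂]`. -/
theorem symbol_mul_diffHom (P : Weyl k n) (f : MvPolynomial (Fin n) k) :
    symbol k (P * diffHom k f) = f • symbol k P := by
  have h : weylAction k (diffHom k f) 1 = f • 1 := by
    rw [← C_1, weylAction_diffHom_C, ← smul_eq_mul, ← C_mul', C_1, mul_one, smul_eq_mul, mul_one]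
  rw [symbol, map_mul, Module.End.mul_apply, h, map_smul, symbol]

theorem mem_leftIdeal_iff (I : Ideal (MvPolynomial (Fin n) k)) (P : Weyl k n) :
    P ∈ leftIdeal k I ↔ ∀ α, coeff α (symbol k P) ∈ I := by
  constructor
  · intro hP
    -- The arbitrary left factor `R` makes the induction hypothesis stable under left
    -- multiplication.
    have h : ∀ R α, coeff α (symbol k (R * P)) ∈ I := by
      refine Submodule.span_induction (p := fun P _ => ∀ R α, coeff α (symbol k (R * P)) ∈ I)
        ?_ ?_ ?_ ?_ (show P ∈ Submodule.span _ _ from hP)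
      · rintro _ ⟨f, hf, rfl⟩ R α
        rw [symbol_mul_diffHom, coeff_smul]
        exact Ideal.mul_mem_right _ _ hf
      · simp [symbol]
      · intro P Q _ _ hP hQ R α
        rw [mul_add, symbol, map_add, LinearMap.add_apply, coeff_add]
        exact add_mem (hP R α) (hQ R α)
      · intro Q P _ hP R α
        rw [smul_eq_mul, ← mul_assoc]
        exact hP _ α
    simpa using h 1
  · intro h
    rw [← normalOrder_symbol k P, (symbol k P).as_sum, map_sum]
    refine sum_mem fun α _ => ?_
    rw [normalOrder_monomial]
    exact Ideal.mul_mem_left _ _ (Ideal.mem_map_of_mem _ (h α))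

end NormalForm

/-! ### The toric ideal as a kernel, and cancellation of monomials modulo it. -/

section Toric

variable (k : Type*) [Field k] {d n : ℕ} (A : Matrix (Fin d) (Fin n) ℤ)

theorem deg_add (u v : Fin n →₀ ℕ) : deg A (u + v) = deg A u + deg A v := by
  ext i
  simp [deg, Matrix.mulVec, dotProduct, mul_add, Finset.sum_add_distrib]

theorem deg_single (j : Fin n) : deg A (Finsupp.single j 1) = fun i => A i j := by
  ext i
  simp [deg, Matrix.mulVec, dotProduct, Finsupp.single_apply]

theorem exists_deg_eq_of_mem_semigroupNA {γ : Fin d → ℤ} (hγ : γ ∈ semigroupNA A) :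
    ∃ u, deg A u = γ := by
  induction hγ using AddSubmonoid.closure_induction with
  | mem x hx => obtain ⟨j, rfl⟩ := hx; exact ⟨_, deg_single A j⟩
  | zero => exact ⟨0, funext (deg_zero A)⟩
  | add x y _ _ hx hy =>
    obtain ⟨u, rfl⟩ := hx
    obtain ⟨v, rfl⟩ := hy
    exact ⟨u + v, deg_add A u v⟩

theorem exists_deg_sub_deg_eq_of_mem_latticeZA {χ : Fin d → ℤ} (hχ : χ ∈ latticeZA A) :
    ∃ u v, deg A u - deg A v = χ := by
  induction hχ using AddSubgroup.closure_induction with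
  | mem x hx =>
    obtain ⟨j, rfl⟩ := hx
    exact ⟨Finsupp.single j 1, 0, by
      rw [deg_single, show deg A 0 = 0 from funext (deg_zero A), sub_zero]⟩
  | zero => exact ⟨0, 0, sub_self _⟩
  | add x y _ _ hx hy =>
    obtain ⟨u, v, rfl⟩ := hx
    obtain ⟨u', v', rfl⟩ := hy
    exact ⟨u + u', v + v', by rw [deg_add, deg_add]; abel⟩
  | neg x _ hx =>
    obtain ⟨u, v, rfl⟩ := hx
    exact ⟨v, u, (neg_sub _ _).symm⟩

/-- The homomorphism `k[∂] → k[ℤ^d]` given by `∂^u ↦ t^{Au}`. -/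
def toricHom : MvPolynomial (Fin n) k →ₐ[k] AddMonoidAlgebra k (Fin d → ℤ) :=
  aeval fun j => AddMonoidAlgebra.single (fun i => A i j) 1

theorem toricHom_monomial (u : Fin n →₀ ℕ) :
    toricHom k A (monomial u 1) = AddMonoidAlgebra.single (deg A u) 1 := by
  induction u using Finsupp.induction_linear with
  | zero =>
    rw [show deg A 0 = 0 from funext (deg_zero A)]
    exact map_one _
  | add u v hu hv =>
    rw [show monomial (u + v) (1 : k) = monomial u 1 * monomial v 1 by simp, map_mul, hu, hv,
      AddMonoidAlgebra.single_mul_single, deg_add, one_mul]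
  | single j m =>
    induction m with
    | zero =>
      rw [Finsupp.single_zero, show deg A 0 = 0 from funext (deg_zero A)]
      exact map_one _
    | succ m ih =>
      rw [Finsupp.single_add,
        show monomial (Finsupp.single j m + Finsupp.single j 1) (1 : k) =
          monomial (Finsupp.single j m) 1 * X j by simp [X], map_mul, ih, deg_add, deg_single,
        toricHom, aeval_X, AddMonoidAlgebra.single_mul_single, one_mul]

/-- Modulo `I_A` a monomial depends only on its degree, so the quotient map factors through
`toricHom`. -/
theorem mem_toricIdeal_iff (f : MvPolynomial (Fin n) k) :
    f ∈ toricIdeal k A ↔ toricHom k A f = 0 := by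
  constructor
  · intro hf
    have h : toricIdeal k A ≤ RingHom.ker (toricHom k A) := by
      refine Ideal.span_le.2 ?_
      rintro _ ⟨u, v, huv, rfl⟩
      simp [RingHom.mem_ker, toricHom_monomial, huv]
    exact h hf
  · intro hf
    classical
    -- `t^a` goes to the class of any monomial of degree `a`; the value `0` at unattained degrees
    -- plays no role on the image of `toricHom`.
    let σ : AddMonoidAlgebra k (Fin d → ℤ) →ₗ[k] MvPolynomial (Fin n) k ⧸ toricIdeal k A :=
      (Finsupp.linearCombination k fun a =>
        if h : ∃ u, deg A u = a then
          Ideal.Quotient.mk (toricIdeal k A) (monomial h.choose (1 : k)) else 0).comp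
        (AddMonoidAlgebra.coeffLinearEquiv k).toLinearMap
    have h : σ.comp (toricHom k A).toLinearMap =
        (Ideal.Quotient.mkₐ k (toricIdeal k A)).toLinearMap := by
      refine linearMap_ext fun u => LinearMap.ext_ring ?_
      have hu : ∃ v, deg A v = deg A u := ⟨u, rfl⟩
      have e : σ (AddMonoidAlgebra.single (deg A u) 1) =
          Ideal.Quotient.mk (toricIdeal k A) (monomial hu.choose (1 : k)) := by
        simp [σ, hu]
      simp only [LinearMap.comp_apply, AlgHom.toLinearMap_apply, toricHom_monomial, e]
      exact Ideal.Quotient.eq.2 (Ideal.subset_span ⟨_, _, hu.choose_spec, rfl⟩)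
    have h' := LinearMap.congr_fun h f
    simp only [LinearMap.comp_apply, AlgHom.toLinearMap_apply, hf, map_zero] at h'
    exact Ideal.Quotient.eq_zero_iff_mem.1 h'.symm

/-- In the group algebra `t^{Au}` has the inverse `t^{-Au}`. -/
theorem mem_toricIdeal_of_monomial_mul_mem (u : Fin n →₀ ℕ) {f : MvPolynomial (Fin n) k}
    (h : monomial u 1 * f ∈ toricIdeal k A) : f ∈ toricIdeal k A := by
  rw [mem_toricIdeal_iff] at h ⊢
  rw [map_mul, toricHom_monomial] at h
  have h' := congrArg (AddMonoidAlgebra.single (-deg A u) (1 : k) * ·) h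
  simpa [← mul_assoc, AddMonoidAlgebra.single_mul_single, ← AddMonoidAlgebra.one_def] using h'

theorem mem_leftIdeal_toricIdeal_of_mul_mem (u : Fin n →₀ ℕ) {P : Weyl k n}
    (h : P * diffHom k (monomial u 1) ∈ leftIdeal k (toricIdeal k A)) :
    P ∈ leftIdeal k (toricIdeal k A) := by
  rw [mem_leftIdeal_iff] at h ⊢
  intro α
  have h' := h α
  rw [symbol_mul_diffHom, coeff_smul, smul_eq_mul] at h'
  exact mem_toricIdeal_of_monomial_mul_mem k A u h'

end Toric

/-! ### The symmetry algebra and its contiguity operators. -/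

section Symmetry

variable {k : Type*} [Field k] {d n : ℕ} {A : Matrix (Fin d) (Fin n) ℤ}

theorem toSymmetry_eq_iff (P Q : preSymmetry k A) :
    toSymmetry k A P = toSymmetry k A Q ↔ (P - Q : Weyl k n) ∈ leftIdeal k (toricIdeal k A) :=
  Ideal.Quotient.eq

theorem toSymmetry_surjective : Function.Surjective (toSymmetry k A) :=
  Ideal.Quotient.mkₐ_surjective _ _

/-- Identities in `S` need only be checked after right multiplication by a single `∂^u`. -/
theorem mul_diffSymm_monomial_cancel (u : Fin n →₀ ℕ) {P Q : Symmetry k A}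
    (h : P * diffSymm k A (monomial u 1) = Q * diffSymm k A (monomial u 1)) : P = Q := by
  obtain ⟨P, rfl⟩ := toSymmetry_surjective P
  obtain ⟨Q, rfl⟩ := toSymmetry_surjective Q
  rw [toSymmetry_eq_iff]
  have h' := (toSymmetry_eq_iff (P * ⟨_, diffHom_mem k A (monomial u 1)⟩)
    (Q * ⟨_, diffHom_mem k A (monomial u 1)⟩)).1 (by rw [map_mul, map_mul]; exact h)
  refine mem_leftIdeal_toricIdeal_of_mul_mem k A u ?_
  rw [sub_mul]
  exact h'

theorem diffSymm_monomial_mul_eulerSymm_X (u : Fin n →₀ ℕ) (i : Fin d) :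
    diffSymm k A (monomial u 1) * eulerSymm k A (X i) =
      eulerSymm k A (X i) * diffSymm k A (monomial u 1) +
        (deg A u i : k) • diffSymm k A (monomial u 1) := by
  refine congrArg (toSymmetry k A) (Subtype.ext ?_)
  have h := diffHom_monomial_mul_euler k A u i
  rw [← show eulerHom k A (X i) = euler k A i from commAeval_X _ _ _] at h
  exact h

theorem mul_eulerSymm {χ : Fin d → ℤ} {P : Symmetry k A} (hP : P ∈ weightSpace k A χ)
    (p : MvPolynomial (Fin d) k) :
    P * eulerSymm k A p = eulerSymm k A (shift k (-χ) p) * P := by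
  induction p using MvPolynomial.induction_on with
  | C c =>
    rw [shift, aeval_C, ← algebraMap_eq, AlgHom.commutes, Algebra.commutes]
  | add p q hp hq => simp only [map_add, mul_add, add_mul, hp, hq]
  | mul_X p i hp =>
    have h := hP i
    have e : eulerSymm k A (shift k (-χ) (X i)) =
        eulerSymm k A (X i) - algebraMap k _ (χ i : k) := by
      rw [shift, aeval_X, map_add, ← algebraMap_eq, AlgHom.commutes]
      simp [sub_eq_add_neg]
    rw [map_mul, map_mul, map_mul, ← mul_assoc, hp, mul_assoc, mul_assoc, e, sub_mul,
      ← Algebra.smul_def, ← h, sub_sub_cancel]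

/-- The operators `P` for which one `E` serves all `u, v` form a left ideal `J`. It contains `I_A`,
with `E = 0`. It contains each `∂^w` with `Aw = χ + Aw'`, with `E = ∂^{w'}`, because `w + v` and `w'
+ u` have the same degree. -/
theorem exists_mul_monomial_sub_mem {χ : Fin d → ℤ} {P : Weyl k n}
    (hP : P ∈ leftIdeal k (toricIdeal k A ⊔ monomialIdeal k A χ)) :
    ∃ E : Weyl k n, ∀ u v : Fin n →₀ ℕ, deg A u - deg A v = χ →
      P * diffHom k (monomial v 1) - E * diffHom k (monomial u 1) ∈
        leftIdeal k (toricIdeal k A) := by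
  let J : Ideal (Weyl k n) :=
    { carrier := {P | ∃ E : Weyl k n, ∀ u v : Fin n →₀ ℕ, deg A u - deg A v = χ →
        P * diffHom k (monomial v 1) - E * diffHom k (monomial u 1) ∈
          leftIdeal k (toricIdeal k A)}
      add_mem' := by
        rintro P Q ⟨E, hE⟩ ⟨F, hF⟩
        refine ⟨E + F, fun u v h => ?_⟩
        rw [add_mul, add_mul, add_sub_add_comm]
        exact add_mem (hE u v h) (hF u v h)
      zero_mem' := ⟨0, fun u v _ => by simp⟩
      smul_mem' := by
        rintro c P ⟨E, hE⟩
        refine ⟨c * E, fun u v h => ?_⟩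
        rw [smul_eq_mul, mul_assoc, mul_assoc, ← mul_sub]
        exact Ideal.mul_mem_left _ _ (hE u v h) }
  have h : toricIdeal k A ⊔ monomialIdeal k A χ ≤ Ideal.comap (diffHom k) J := by
    refine sup_le ?_ (Ideal.span_le.2 ?_)
    · intro f hf
      refine ⟨0, fun u v _ => ?_⟩
      rw [zero_mul, sub_zero, ← map_mul]
      exact Ideal.mem_map_of_mem _ (Ideal.mul_mem_right _ _ hf)
    · rintro _ ⟨w, ⟨γ, hγ, hw⟩, rfl⟩
      obtain ⟨w', rfl⟩ := exists_deg_eq_of_mem_semigroupNA A hγ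
      refine ⟨diffHom k (monomial w' 1), fun u v huv => ?_⟩
      rw [← map_mul, ← map_mul, ← map_sub, monomial_mul, monomial_mul, one_mul]
      refine Ideal.mem_map_of_mem _ (Ideal.subset_span ⟨_, _, ?_, rfl⟩)
      rw [deg_add, deg_add, hw, ← huv]
      abel
  have h' : leftIdeal k (toricIdeal k A ⊔ monomialIdeal k A χ) ≤ J := by
    refine Submodule.span_le.2 ?_
    rintro _ ⟨f, hf, rfl⟩
    exact h hf
  exact h' hP

theorem mul_diffHom_mem {P : Weyl k n} (hP : P ∈ leftIdeal k (toricIdeal k A))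
    (f : MvPolynomial (Fin n) k) : P * diffHom k f ∈ leftIdeal k (toricIdeal k A) := by
  rw [mem_leftIdeal_iff] at hP ⊢
  intro α
  rw [symbol_mul_diffHom, coeff_smul]
  exact Ideal.mul_mem_left _ _ (hP α)

theorem exists_isContiguity {χ : Fin d → ℤ} (hχ : χ ∈ latticeZA A)
    {b : MvPolynomial (Fin d) k} (hb : b ∈ bIdeal k A χ) : ∃ E, IsContiguity k A χ b E := by
  obtain ⟨E, hE⟩ := exists_mul_monomial_sub_mem (A := A) (χ := χ) (P := eulerHom k A b) hb
  obtain ⟨u, v, huv⟩ := exists_deg_sub_deg_eq_of_mem_latticeZA A hχ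
  -- For `f ∈ I_A`, `f E ∂^u ≡ f b ∂^v ≡ 0` modulo `D I_A`, since `b` is itself a symmetry; then
  -- `∂^u` cancels.
  have hmem : E ∈ preSymmetry k A := by
    intro f hf
    refine mem_leftIdeal_toricIdeal_of_mul_mem k A u ?_
    have h1 := Ideal.mul_mem_left _ (diffHom k f) (hE u v huv)
    have h2 := mul_diffHom_mem (eulerHom_mem k A b f hf) (monomial v 1)
    rw [mul_sub, ← mul_assoc, ← mul_assoc] at h1
    exact (Submodule.sub_mem_iff_right _ h2).1 h1
  have hrel : ∀ u v : Fin n →₀ ℕ, deg A u - deg A v = χ →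
      eulerSymm k A b * diffSymm k A (monomial v 1) =
        toSymmetry k A ⟨E, hmem⟩ * diffSymm k A (monomial u 1) :=
    fun u v h => Ideal.Quotient.eq.2 (hE u v h)
  refine ⟨toSymmetry k A ⟨E, hmem⟩, fun i => ?_, hrel⟩
  -- After multiplication by `∂^u`, every `E ∂^u` becomes `b ∂^v`. Since `b` commutes with `s_i`,
  -- moving `s_i` past `∂^u` and `∂^v` leaves the factor `(Au - Av)_i = χ_i`.
  refine mul_diffSymm_monomial_cancel u ?_
  generalize toSymmetry k A ⟨E, hmem⟩ = F at hrel
  have h := hrel u v huv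
  have hu := diffSymm_monomial_mul_eulerSymm_X (k := k) (A := A) u i
  have hv := diffSymm_monomial_mul_eulerSymm_X (k := k) (A := A) v i
  have hc : eulerSymm k A (X i) * eulerSymm k A b = eulerSymm k A b * eulerSymm k A (X i) := by
    rw [← map_mul, ← map_mul, mul_comm]
  rw [sub_mul, mul_assoc, mul_assoc, ← sub_eq_iff_eq_add.2 hu, mul_sub, ← mul_assoc F, ← h,
    mul_smul_comm, ← h, mul_assoc, hv, ← mul_assoc, hc, smul_mul_assoc, ← h, ← huv]
  simp only [mul_add, mul_smul_comm, Pi.sub_apply, Int.cast_sub, sub_smul, mul_assoc]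
  abel

/-- `Q P ∂^u = Q p(s) ∂^v = p(s + χ) Q ∂^v = p(s + χ) q(s) ∂^u`, and `∂^u` cancels. -/
theorem IsContiguity.mul_eq {χ : Fin d → ℤ} (hχ : χ ∈ latticeZA A)
    {p q : MvPolynomial (Fin d) k} {P Q : Symmetry k A} (hP : IsContiguity k A χ p P)
    (hQ : IsContiguity k A (-χ) q Q) : Q * P = eulerSymm k A (shift k χ p * q) := by
  obtain ⟨u, v, huv⟩ := exists_deg_sub_deg_eq_of_mem_latticeZA A hχ
  refine mul_diffSymm_monomial_cancel u ?_
  rw [mul_assoc, ← hP.2 u v huv, ← mul_assoc, mul_eulerSymm hQ.1, neg_neg, mul_assoc,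
    ← hQ.2 v u (by rw [← huv, neg_sub]), ← mul_assoc, ← map_mul]

/-! ### Right multiplication between hypergeometric systems. -/

theorem leftIdeal_le_hypergeomIdeal (β : Fin d → k) :
    leftIdeal k (toricIdeal k A) ≤ hypergeomIdeal k A β := le_sup_left

/-- The induction step is `p s_i - p(β) β_i = p (s_i - β_i) + β_i (p - p(β))`. -/
theorem eulerHom_sub_eval_mem (β : Fin d → k) (p : MvPolynomial (Fin d) k) :
    eulerHom k A p - algebraMap k _ (eval β p) ∈ hypergeomIdeal k A β := by
  induction p using MvPolynomial.induction_on with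
  | C c => rw [eval_C, ← algebraMap_eq, AlgHom.commutes, sub_self]; exact zero_mem _
  | add p q hp hq =>
    rw [map_add, map_add, map_add, add_sub_add_comm]; exact add_mem hp hq
  | mul_X p i hp =>
    have h : euler k A i - algebraMap k _ (β i) ∈ hypergeomIdeal k A β :=
      (le_sup_right : _ ≤ hypergeomIdeal k A β) (Ideal.subset_span ⟨i, rfl⟩)
    have e : eulerHom k A (p * X i) - algebraMap k _ (eval β (p * X i)) =
        eulerHom k A p * (euler k A i - algebraMap k _ (β i)) +
          algebraMap k _ (β i) * (eulerHom k A p - algebraMap k _ (eval β p)) := by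
      rw [map_mul, map_mul, eval_X, map_mul, show eulerHom k A (X i) = euler k A i from
        commAeval_X _ _ _, mul_sub, mul_sub, ← Algebra.commutes (β i), ← Algebra.commutes (β i)]
      abel
    rw [e]
    exact add_mem (Ideal.mul_mem_left _ _ h) (Ideal.mul_mem_left _ _ hp)

theorem mul_mem_of_mem_leftIdeal {P : Weyl k n} (hP : P ∈ leftIdeal k (toricIdeal k A))
    {R : Weyl k n} (hR : R ∈ preSymmetry k A) : P * R ∈ leftIdeal k (toricIdeal k A) := by
  refine Submodule.span_induction
    (p := fun P _ => P * R ∈ leftIdeal k (toricIdeal k A)) ?_ ?_ ?_ ?_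
    (show P ∈ Submodule.span _ _ from hP)
  · rintro _ ⟨g, hg, rfl⟩
    exact hR g hg
  · simp
  · intro P Q _ _ h h'
    rw [add_mul]; exact add_mem h h'
  · intro c P _ h
    rw [smul_eq_mul, mul_assoc]; exact Ideal.mul_mem_left _ _ h

/-- Modulo `D I_A`, weight `χ` means `(s_i - β_i) R ≡ R (s_i - (β_i - χ_i))`. -/
theorem euler_sub_mul_mem {χ : Fin d → ℤ} {R : preSymmetry k A}
    (hR : toSymmetry k A R ∈ weightSpace k A χ) (β : Fin d → k) (i : Fin d) :
    (euler k A i - algebraMap k _ (β i)) * (R : Weyl k n) ∈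
      hypergeomIdeal k A (β - castVec k χ) := by
  have h : eulerHom k A (X i) * R - R * eulerHom k A (X i) - (χ i : k) • (R : Weyl k n) ∈
      leftIdeal k (toricIdeal k A) :=
    (toSymmetry_eq_iff (⟨_, eulerHom_mem k A (X i)⟩ * R - R * ⟨_, eulerHom_mem k A (X i)⟩)
      ((χ i : k) • R)).1 (hR i)
  rw [show eulerHom k A (X i) = euler k A i from commAeval_X _ _ _] at h
  have h' : euler k A i - algebraMap k _ ((β - castVec k χ) i) ∈
      hypergeomIdeal k A (β - castVec k χ) :=
    (le_sup_right : _ ≤ hypergeomIdeal k A _) (Ideal.subset_span ⟨i, rfl⟩)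
  have e : (euler k A i - algebraMap k _ (β i)) * (R : Weyl k n) =
      (euler k A i * R - R * euler k A i - (χ i : k) • (R : Weyl k n)) +
        R * (euler k A i - algebraMap k _ ((β - castVec k χ) i)) := by
    rw [Pi.sub_apply, castVec, map_sub, mul_sub, mul_sub, ← Algebra.commutes, ← Algebra.commutes,
      sub_mul, Algebra.smul_def]
    abel
  rw [e]
  exact add_mem (leftIdeal_le_hypergeomIdeal _ h) (Ideal.mul_mem_left _ _ h')

/-- Right multiplication by an operator of weight `χ` induces a homomorphism
`M_A(β) → M_A(β - χ)`. -/
theorem exists_isRightMul {χ : Fin d → ℤ} {P : Symmetry k A} (hP : P ∈ weightSpace k A χ)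
    {β β' : Fin d → k} (hβ : β' = β - castVec k χ) :
    ∃ f : HypergeomSystem k A β →ₗ[Weyl k n] HypergeomSystem k A β', IsRightMul k A f P := by
  subst hβ
  obtain ⟨R, rfl⟩ := toSymmetry_surjective P
  have h : hypergeomIdeal k A β ≤ Submodule.comap
      (LinearMap.toSpanSingleton (Weyl k n) (Weyl k n) (R : Weyl k n))
      (hypergeomIdeal k A (β - castVec k χ)) := by
    refine sup_le ?_ (Ideal.span_le.2 ?_)
    · intro Z hZ
      exact leftIdeal_le_hypergeomIdeal _ (mul_mem_of_mem_leftIdeal hZ R.2)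
    · rintro _ ⟨i, rfl⟩
      exact euler_sub_mul_mem hP β i
  refine ⟨Submodule.mapQ _ _ _ h, fun R' hR' Z => ?_⟩
  rw [Submodule.mapQ_apply]
  -- Two representatives differ by an element of `D I_A`, which is contained in the target's ideal.
  refine (Submodule.Quotient.eq _).2 ?_
  rw [LinearMap.toSpanSingleton_apply, smul_eq_mul, ← mul_sub]
  exact Ideal.mul_mem_left _ _ (leftIdeal_le_hypergeomIdeal _
    ((toSymmetry_eq_iff R R').1 hR'.symm))

/-- Right multiplications compose in reverse order, so `g ∘ f` sends the class of `Z` to that of `Z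
Q P`. This equals the class of `Z r(s)`, and `r(s) - r(β)` lies in `H_A(β)`. -/
theorem IsRightMul.comp_apply {β β' : Fin d → k} {P Q : Symmetry k A}
    {f : HypergeomSystem k A β → HypergeomSystem k A β'}
    {g : HypergeomSystem k A β' → HypergeomSystem k A β}
    (hf : IsRightMul k A f Q) (hg : IsRightMul k A g P) {r : MvPolynomial (Fin d) k}
    (h : Q * P = eulerSymm k A r) (m : HypergeomSystem k A β) : g (f m) = eval β r • m := by
  obtain ⟨P, rfl⟩ := toSymmetry_surjective P
  obtain ⟨Q, rfl⟩ := toSymmetry_surjective Q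
  obtain ⟨Z, rfl⟩ := Submodule.Quotient.mk_surjective _ m
  rw [hf Q rfl, hg P rfl, ← Submodule.Quotient.mk_smul]
  refine (Submodule.Quotient.eq _).2 ?_
  have h1 : (Q * P - eulerHom k A r : Weyl k n) ∈ hypergeomIdeal k A β :=
    leftIdeal_le_hypergeomIdeal _
      ((toSymmetry_eq_iff (Q * P) ⟨_, eulerHom_mem k A r⟩).1 h)
  have e : Z * Q * P - eval β r • Z =
      Z * (Q * P - eulerHom k A r) + Z * (eulerHom k A r - algebraMap k _ (eval β r)) := by
    rw [mul_sub, mul_sub, ← Algebra.commutes, ← Algebra.smul_def, mul_assoc]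
    abel
  rw [e]
  exact add_mem (Ideal.mul_mem_left _ _ h1)
    (Ideal.mul_mem_left _ _ (eulerHom_sub_eval_mem β r))

theorem bijective_of_comp_eq_smul {R V W : Type*} [Field R] [AddCommGroup V] [Module R V]
    [AddCommGroup W] [Module R W] {f : V → W} {g : W → V} {c : R} (hc : c ≠ 0)
    (hgf : ∀ m, g (f m) = c • m) (hfg : ∀ m, f (g m) = c • m) : Function.Bijective f := by
  refine ⟨fun a b h => ?_, fun b => ⟨g (c⁻¹ • b), ?_⟩⟩
  · have h' := congrArg g h
    rw [hgf, hgf] at h'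
    exact smul_right_injective V hc h'
  · rw [hfg, smul_inv_smul₀ hc]

theorem eval_shift (χ : Fin d → ℤ) (β : Fin d → k) (p : MvPolynomial (Fin d) k) :
    eval β (shift k χ p) = eval (β + castVec k χ) p := by
  induction p using MvPolynomial.induction_on with
  | C c => rw [shift, aeval_C, algebraMap_eq, eval_C, eval_C]
  | add p q hp hq => simp only [map_add, hp, hq]
  | mul_X p i hp =>
    rw [map_mul, map_mul, hp, map_mul]
    simp [shift, castVec]

theorem exists_eval_ne_zero_of_notMem_zeroLocus {χ : Fin d → ℤ} {β : Fin d → k}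
    (hβ : β ∉ zeroLocus k (bbIdeal k A χ)) : ∃ p ∈ bIdeal k A χ, ∃ q ∈ bIdeal k A (-χ),
      eval (β + castVec k χ) p * eval β q ≠ 0 := by
  by_contra! h
  refine hβ ((mem_zeroLocus_iff).2 fun f hf => ?_)
  have h' : bbIdeal k A χ ≤ RingHom.ker (eval β) := by
    refine Ideal.span_le.2 ?_
    rintro _ ⟨p, hp, q, hq, rfl⟩
    rw [SetLike.mem_coe, RingHom.mem_ker, map_mul, eval_shift]
    exact h p hp q hq
  exact h' hf

end Symmetry

end

end GKZ

theorem theorem4p12 {k : Type*} [Field k] [CharZero k] {d n : ℕ}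
    (A : Matrix (Fin d) (Fin n) ℤ)
    (hrank : (A.map (Int.cast : ℤ → ℚ)).rank = d)
    (hhyp : ∃ h : Fin d → ℚ, ∀ j, ∑ i, h i * (A i j : ℚ) = 1)
    (χ : Fin d → ℤ) (hχ : χ ∈ GKZ.latticeZA A) (β : Fin d → k)
    (hβ : β ∉ MvPolynomial.zeroLocus k (GKZ.bbIdeal k A χ)) :
    Nonempty (GKZ.HypergeomSystem k A β ≃ₗ[GKZ.Weyl k n]
      GKZ.HypergeomSystem k A (β + GKZ.castVec k χ)) ∧
    (∃ p ∈ GKZ.bIdeal k A χ, ∃ q ∈ GKZ.bIdeal k A (-χ),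
      MvPolynomial.eval (β + GKZ.castVec k χ) p * MvPolynomial.eval β q ≠ 0) ∧
    ∀ p ∈ GKZ.bIdeal k A χ, ∀ q ∈ GKZ.bIdeal k A (-χ),
      MvPolynomial.eval (β + GKZ.castVec k χ) p * MvPolynomial.eval β q ≠ 0 →
      (∃ P, GKZ.IsContiguity k A χ p P) ∧
      (∃ Q, GKZ.IsContiguity k A (-χ) q Q) ∧
      ∀ P Q : GKZ.Symmetry k A,
        GKZ.IsContiguity k A χ p P → GKZ.IsContiguity k A (-χ) q Q →
        Q * P = GKZ.eulerSymm k A (GKZ.shift k χ p * q) ∧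
        P * Q = GKZ.eulerSymm k A (GKZ.shift k (-χ) q * p) ∧
        ∃ (f : GKZ.HypergeomSystem k A β ≃ₗ[GKZ.Weyl k n]
              GKZ.HypergeomSystem k A (β + GKZ.castVec k χ))
          (g : GKZ.HypergeomSystem k A (β + GKZ.castVec k χ) ≃ₗ[GKZ.Weyl k n]
              GKZ.HypergeomSystem k A β),
          GKZ.IsRightMul k A f Q ∧ GKZ.IsRightMul k A g P ∧
          (∀ m, g (f m) =
            (MvPolynomial.eval (β + GKZ.castVec k χ) p * MvPolynomial.eval β q) • m) ∧
          (∀ m, f (g m) =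
            (MvPolynomial.eval (β + GKZ.castVec k χ) p * MvPolynomial.eval β q) • m) := by

  have key : ∀ p ∈ GKZ.bIdeal k A χ, ∀ q ∈ GKZ.bIdeal k A (-χ),
      MvPolynomial.eval (β + GKZ.castVec k χ) p * MvPolynomial.eval β q ≠ 0 →
      (∃ P, GKZ.IsContiguity k A χ p P) ∧
      (∃ Q, GKZ.IsContiguity k A (-χ) q Q) ∧
      ∀ P Q : GKZ.Symmetry k A,
        GKZ.IsContiguity k A χ p P → GKZ.IsContiguity k A (-χ) q Q →
        Q * P = GKZ.eulerSymm k A (GKZ.shift k χ p * q) ∧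
        P * Q = GKZ.eulerSymm k A (GKZ.shift k (-χ) q * p) ∧
        ∃ (f : GKZ.HypergeomSystem k A β ≃ₗ[GKZ.Weyl k n]
              GKZ.HypergeomSystem k A (β + GKZ.castVec k χ))
          (g : GKZ.HypergeomSystem k A (β + GKZ.castVec k χ) ≃ₗ[GKZ.Weyl k n]
              GKZ.HypergeomSystem k A β),
          GKZ.IsRightMul k A f Q ∧ GKZ.IsRightMul k A g P ∧
          (∀ m, g (f m) =
            (MvPolynomial.eval (β + GKZ.castVec k χ) p * MvPolynomial.eval β q) • m) ∧
          (∀ m, f (g m) =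
            (MvPolynomial.eval (β + GKZ.castVec k χ) p * MvPolynomial.eval β q) • m) := by
    intro p hp q hq hc
    have hχ' : -χ ∈ GKZ.latticeZA A := neg_mem hχ
    refine ⟨GKZ.exists_isContiguity hχ hp, GKZ.exists_isContiguity hχ' hq, fun P Q hP hQ => ?_⟩
    have hQP := hP.mul_eq hχ hQ
    -- The same product formula for `-χ`, with the two operators exchanged.
    have hPQ := hQ.mul_eq hχ' (by rwa [neg_neg] : GKZ.IsContiguity k A (- -χ) p P)
    refine ⟨hQP, hPQ, ?_⟩
    have hneg : GKZ.castVec k (-χ) = -GKZ.castVec k χ := by ext i; simp [GKZ.castVec]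
    -- `Q` has weight `-χ`, so right multiplication by it raises the parameter by `χ`.
    obtain ⟨f, hf⟩ := GKZ.exists_isRightMul hQ.1
      (show β + GKZ.castVec k χ = β - GKZ.castVec k (-χ) by rw [hneg, sub_neg_eq_add])
    obtain ⟨g, hg⟩ := GKZ.exists_isRightMul hP.1
      (show β = β + GKZ.castVec k χ - GKZ.castVec k χ by rw [add_sub_cancel_right])
    have hgf := hf.comp_apply hg hQP
    have hfg := hg.comp_apply hf hPQ
    rw [map_mul, GKZ.eval_shift] at hgf
    -- At `β + χ` the polynomial `q(s - χ) p(s)` takes the value `q(β) p(β + χ)`, the same constant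
    -- as for `g ∘ f`.
    rw [map_mul, GKZ.eval_shift, hneg, add_neg_cancel_right, mul_comm] at hfg
    exact ⟨LinearEquiv.ofBijective f (GKZ.bijective_of_comp_eq_smul hc hgf hfg),
      LinearEquiv.ofBijective g (GKZ.bijective_of_comp_eq_smul hc hfg hgf), hf, hg, hgf, hfg⟩
  have hpq := GKZ.exists_eval_ne_zero_of_notMem_zeroLocus hβ
  refine ⟨?_, hpq, key⟩
  obtain ⟨p, hp, q, hq, hc⟩ := hpq
  obtain ⟨⟨P, hP⟩, ⟨Q, hQ⟩, h⟩ := key p hp q hq hc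
  obtain ⟨-, -, f, -⟩ := h P Q hP hQ
  exact ⟨f⟩
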